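/- Let $N=(V,E,\sigma)$ be a finite network, i.e. $(V,E)$ is a finite connected undirected graph and $\sigma$ assigns a positive integer cost to every edge; let $R\subseteq V$ be a set of terminals, $r\in R$, and $R'=R\setminus\{r\}$. For $A\subseteq V$ let $\mathrm{csmt}(N,A)$ be the least cost (sum of edge costs) of a tree in $(V,E)$ that contains all vertices of $A$; a tree attaining it is a Steiner minimal tree for $(N,A)$. Put $l^*(u,I)=\mathrm{csmt}(N,I\cup\{u\})$. A Steiner heuristic is a function $h^*:V\times 2^R\to\mathbb{Z}_{\ge 0}$; it is admissible if $h^*(u,I)\le l^*(u,I)$ for all $u\in V$ and $\{r\}\subseteq I\subseteq R$. The algorithm DS* works on tuples $(u,I)$ with $u\in V$, $I\subseteq R'$. Initially $l(u,\{u\})=0$ for $u\in R'$, $l(u,\emptyset)=0$ for $u\in V$, all other $l(u,I)$ are $\infty$, all retrace sets $b(u,I)$ are empty, $Q=\{(u,\{u\}) : u\in R'\}$ and $P=\emptyset$. While $(r,R')\notin P$ and $Q\neq\emptyset$: choose $(u,I)\in Q$ minimizing $l(u,I)+h^*(u,R\setminus I)$ (ties broken arbitrarily), remove it from $Q$ and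 add it to $P$; then, in any order, for each $\emptyset\ne J\subseteq R'\setminus I$ with $(u,J)\in P$ and $l(u,I)+l(u,J)<l(u,I\cup J)$, set $l(u,I\cup J)\leftarrow l(u,I)+l(u,J)$ and $b(u,I\cup J)\leftarrow\{(u,I),(u,J)\}$ and, unless $\mathit{prune\_combine}(u,I,J)$ answers true, add $(u,I\cup J)$ to $Q$; then, in any order, for each neighbour $v$ of $u$ with $l(u,I)+\sigma(\{u,v\})<l(v,I)$, set $l(v,I)\leftarrow l(u,I)+\sigma(\{u,v\})$ and $b(v,I)\leftarrow\{(u,I)\}$ and, unless $\mathit{prune}(u,I)$ answers true, add $(v,I)$ to $Q$. At the end a tree is retraced from $(r,R')$ by recursion along the sets $b$. Pruning uses upper bounds $U(J)$ (initially undefined, i.e. $\infty$) and sets $S(J)$. Let $d_N(x,y)$ be the least cost of a connected subgraph containing $x$ and $y$, and $sd(A,B)=\min_{x\in A,\,y\in B}d_N(x,y)$. The call $\mathit{prune}(v,J)$ replaces $U(J)$ by $\min\{U(J),\,l(v,J)+\min\{sd(J,R\setminus J),sd(\{v\},R\setminus J)\}\}$; if this changes $U(J)$, it sets $S(J)\leftarrow\{z\}$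 for some $z\in R\setminus J$ attaining the inner minimum; it answers true if and only if $l(v,J)>U(J)$. The call $\mathit{prune\_combine}(v,J_1,J_2)$ first checks whether $U(J_1),U(J_2)$ are both defined and $S(J_1)\cap J_2=\emptyset$ or $S(J_2)\cap J_1=\emptyset$; if so, it sets $U(J_1\cup J_2)\leftarrow U(J_1)+U(J_2)$ and $S(J_1\cup J_2)\leftarrow(S(J_1)\cup S(J_2))\setminus(J_1\cup J_2)$. It then proceeds as $\mathit{prune}(v,J_1\cup J_2)$. In the version without pruning both calls always answer false. Theorem. Let $h^*$ be admissible. Then every run of DS*, with as well as without pruning, terminates: the main loop performs finitely many iterations; if $R\neq\{r\}$ it ends because $(r,R')\in P$, so the queue is never empty before; and the final retracing recursion from $(r,R')$ ends. After termination, $l(r,R')$ is the cost of a Steiner minimal tree for $(N,R)$, i.e. $l(r,R')=l^*(r,R')=\mathrm{csmt}(N,R)$. -/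

import Mathlib

namespace DSStar

/-- An undirected network `N = (V, E, σ)`: a connected graph on the vertex type `V` whose edges
carry positive integer costs. (`cost` is only ever evaluated on edges.) -/
structure Network (V : Type*) where
  graph : SimpleGraph V
  connected : graph.Connected
  cost : Sym2 V → ℕ
  cost_pos : ∀ e ∈ graph.edgeSet, 0 < cost e

section SteinerTrees

variable {V : Type*} [Finite V] (N : Network V)

/-- The cost `c_N(H)` of a sub-graph: the sum of its edge costs. -/
noncomputable def subgraphCost (H : N.graph.Subgraph) : ℕ :=
  ∑ e ∈ (Set.toFinite H.edgeSet).toFinset, N.cost e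

/-- The distance `d_N(u, v)`: the least cost of a connected sub-graph containing `u` and `v`. -/
noncomputable def netDist (u v : V) : ℕ :=
  sInf {c | ∃ H : N.graph.Subgraph, H.Connected ∧ u ∈ H.verts ∧ v ∈ H.verts ∧
    subgraphCost N H = c}

/-- `T` is a Steiner tree for the terminal set `R`: a sub-graph that is a tree and contains `R`.
(Which terminal is declared to be the root has no influence on the cost.) -/
def IsSteinerTree (R : Finset V) (T : N.graph.Subgraph) : Prop :=
  T.coe.IsTree ∧ (R : Set V) ⊆ T.verts

/-- `T` is a Steiner minimal tree (SMT) for `(N, R)`. -/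
def IsSMT (R : Finset V) (T : N.graph.Subgraph) : Prop :=
  IsSteinerTree N R T ∧ ∀ T' : N.graph.Subgraph, IsSteinerTree N R T' →
    subgraphCost N T ≤ subgraphCost N T'

/-- `csmt(N, R)`: the minimum of the costs of the Steiner trees for `(N, R)`. -/
noncomputable def csmt (R : Finset V) : ℕ :=
  sInf {c | ∃ T : N.graph.Subgraph, IsSteinerTree N R T ∧ subgraphCost N T = c}

variable [DecidableEq V]

/-- The sub-SMT costs `l*(u, I) = csmt(N, I ∪ {u})`. -/
noncomputable def lstar (u : V) (I : Finset V) : ℕ :=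
  csmt N (I ∪ {u})

/-- Admissibility of a Steiner heuristic: `h*(u, I) ≤ l*(u, I)` for all `u ∈ V` and
`{r} ⊆ I ⊆ R`. Values of `h` at sets that are not subsets of `R` play no role. -/
def Admissible (R : Finset V) (r : V) (h : V → Finset V → ℕ) : Prop :=
  ∀ (u : V) (I : Finset V), {r} ⊆ I → I ⊆ R → h u I ≤ lstar N u I

/-- The set distance `sd(A, B) = min {d_N(x, y) | x ∈ A, y ∈ B}`. -/
noncomputable def setDist (A B : Finset V) : ℕ∞ :=
  ⨅ x ∈ A, ⨅ y ∈ B, (netDist N x y : ℕ∞)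

end SteinerTrees

/-! ### The program state -/

/-- A tuple `(u, I)` of a vertex and a set of terminals. -/
abbrev Tuple (V : Type*) := V × Finset V

/-- The variables of the algorithm: tentative costs `l`, retrace sets `b`, the queue `Q`, the set
`P` of expanded tuples, and the data `U` (upper bounds; `⊤` stands for "undefined") and `S` of the
pruning functions. -/
structure State (V : Type*) where
  l : Tuple V → ℕ∞
  b : Tuple V → Finset (Tuple V)
  Q : Finset (Tuple V)
  P : Finset (Tuple V)
  U : Finset V → ℕ∞
  S : Finset V → Finset V

/-! ### Loops

A loop `foreach x with p x do body` visits the finitely many `x` with `p x` in an arbitrary order.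
Statements are relations between the state before and the state after. -/

/-- Execute `body a` for the entries `a` of a list, one after the other. -/
def RunList {α σ : Type*} (body : α → σ → σ → Prop) : List α → σ → σ → Prop
  | [], s, t => t = s
  | a :: L, s, t => ∃ m, body a s m ∧ RunList body L m t

/-- Execute `body x` once for every `x` with `p x`, in an arbitrary order. -/
def ForEach {α σ : Type*} (p : α → Prop) (body : α → σ → σ → Prop) (s t : σ) : Prop :=
  ∃ L : List α, L.Nodup ∧ (∀ x, x ∈ L ↔ p x) ∧ RunList body L s t

section Algorithm

variable {V : Type*} [Finite V] [DecidableEq V]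

/-- `l(x) ← c; b(x) ← B`. -/
def State.assign (s : State V) (x : Tuple V) (c : ℕ∞) (B : Finset (Tuple V)) : State V :=
  { s with l := Function.update s.l x c, b := Function.update s.b x B }

/-- `Q ← Q ∪ {x}`. -/
def State.push (s : State V) (x : Tuple V) : State V :=
  { s with Q := s.Q ∪ {x} }

/-- `Q ← Q \ {x}; P ← P ∪ {x}`. -/
def State.expand (s : State V) (x : Tuple V) : State V :=
  { s with Q := s.Q \ {x}, P := s.P ∪ {x} }

/-- The state before the first iteration of the main loop. -/
def start (R : Finset V) (r : V) : State V where
  l x := if x.2 = ∅ ∨ (x.1 ∈ R \ {r} ∧ x.2 = {x.1}) then 0 else ⊤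
  b _ := ∅
  Q := (R \ {r}).image fun u => (u, {u})
  P := ∅
  U _ := ⊤
  S _ := ∅

variable (N : Network V) (R : Finset V)

/-- `U(J) ← min {U(J), l(v, J) + min {sd(J, R \ J), sd({v}, R \ J)}}`, and, if this changes `U(J)`,
then `S(J) ← {z}` for a terminal `z ∈ R \ J` at which the minimum is attained. -/
def UpdateBound (v : V) (J : Finset V) (s t : State V) : Prop :=
  let D := min (setDist N J (R \ J)) (setDist N {v} (R \ J))
  (s.U J ≤ s.l (v, J) + D ∧ t = s) ∨
  (s.l (v, J) + D < s.U J ∧ ∃ z ∈ R \ J, min (setDist N J {z}) (setDist N {v} {z}) = D ∧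
    t = { s with U := Function.update s.U J (s.l (v, J) + D), S := Function.update s.S J {z} })

/-- The call `prune(v, J)` in state `s` answers `ans` and leaves the state `t`. -/
def Prune (v : V) (J : Finset V) (s : State V) (ans : Bool) (t : State V) : Prop :=
  UpdateBound N R v J s t ∧ (ans = true ↔ t.U J < t.l (v, J))

/-- Combination of the upper bounds of `J₁` and `J₂`, if both are defined and
`S(J₁) ∩ J₂ = ∅` or `S(J₂) ∩ J₁ = ∅`. -/
def combineBounds (J₁ J₂ : Finset V) (s : State V) : State V :=
  if s.U J₁ ≠ ⊤ ∧ s.U J₂ ≠ ⊤ ∧ (s.S J₁ ∩ J₂ = ∅ ∨ s.S J₂ ∩ J₁ = ∅) then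
    { s with
      U := Function.update s.U (J₁ ∪ J₂) (s.U J₁ + s.U J₂)
      S := Function.update s.S (J₁ ∪ J₂) ((s.S J₁ ∪ s.S J₂) \ (J₁ ∪ J₂)) }
  else s

/-- The call `prune_combine(v, J₁, J₂)` in state `s` answers `ans` and leaves the state `t`. -/
def PruneCombine (v : V) (J₁ J₂ : Finset V) (s : State V) (ans : Bool) (t : State V) : Prop :=
  Prune N R v (J₁ ∪ J₂) (combineBounds J₁ J₂ s) ans t

variable (pruning : Bool)

/-- Body of the combination loop: the expanded tuple `(u, I)` is combined with `(u, J)`. If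
`pruning = false`, there is no pruning: the improved tuple is always put into the queue. -/
def CombineBody (u : V) (I J : Finset V) (s t : State V) : Prop :=
  if s.l (u, I) + s.l (u, J) < s.l (u, I ∪ J) then
    let s₁ := s.assign (u, I ∪ J) (s.l (u, I) + s.l (u, J)) {(u, I), (u, J)}
    ∃ (ans : Bool) (m : State V),
      (if pruning then PruneCombine N R u I J s₁ ans m else ans = false ∧ m = s₁) ∧
      t = if ans then m else m.push (u, I ∪ J)
  else t = s

/-- Body of the propagation loop: the expanded tuple `(u, I)` is propagated to the neighbour `v`. -/
def PropagateBody (u : V) (I : Finset V) (v : V) (s t : State V) : Prop :=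
  if s.l (u, I) + N.cost s(u, v) < s.l (v, I) then
    let s₁ := s.assign (v, I) (s.l (u, I) + N.cost s(u, v)) {(u, I)}
    ∃ (ans : Bool) (m : State V),
      (if pruning then Prune N R u I s₁ ans m else ans = false ∧ m = s₁) ∧
      t = if ans then m else m.push (v, I)
  else t = s

variable (r : V) (h : V → Finset V → ℕ)

/-- The estimate `l(u, I) + h*(u, R \ I)` of a tuple. -/
def estimate (s : State V) (x : Tuple V) : ℕ∞ :=
  s.l x + h x.1 (R \ x.2)

/-- One iteration of the main loop `while (r, R \ {r}) ∉ P`: some tuple of the queue with the least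
estimate is expanded (ties are broken arbitrarily). There is no iteration from a state whose queue
is empty. -/
def Step (s t : State V) : Prop :=
  (r, R \ {r}) ∉ s.P ∧
  ∃ (u : V) (I : Finset V), (u, I) ∈ s.Q ∧
    (∀ y ∈ s.Q, estimate R h s (u, I) ≤ estimate R h s y) ∧
    ∃ m : State V,
      ForEach (fun J => J ≠ ∅ ∧ J ⊆ (R \ {r}) \ I ∧ (u, J) ∈ s.P ∪ {(u, I)})
        (CombineBody N R pruning u I) (s.expand (u, I)) m ∧
      ForEach (fun v => N.graph.Adj u v) (PropagateBody N R pruning u I) m t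

/-- The states that can occur at the head of the main loop. -/
def Reachable (s : State V) : Prop :=
  Relation.ReflTransGen (Step N R pruning r h) (start R r) s

/-- The main loop has come to an end in the state `s`: there is no further iteration. -/
def Halted (s : State V) : Prop :=
  ¬ ∃ t, Step N R pruning r h s t

end Algorithm

/-- The recursion that retraces a tree from the tuple `x`, by calling itself on all tuples of the
retrace set `b(x)`, comes to an end. -/
def RetraceTerminates {V : Type*} (s : State V) (x : Tuple V) : Prop :=
  Acc (fun z y => z ∈ s.b y) x

end DSStar

/-! Only tuples that split an optimum matter: `(u, I)` satisfies `Splits` when optimal trees for `I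
∪ {u}` and `(R \ I) ∪ {u}` together cost at most `csmt N R`. Pruning cannot discard such a tuple
once its label is exact (`Tight`). A defined bound `U I` pays for edges linking each vertex of `I`
to a terminal outside `I`; adding an optimal tree for `(u, R \ I)` connects all of `R`. So `csmt N R
≤ U I + lstar N u (R \ I)`, hence `lstar N u I ≤ U I` (`BoundsValid.lstar_le`).

At the loop head, therefore, every exact splitting tuple is queued or expanded, and if it is not
queued, its propagations and combinations have been carried out (`HeadInv`). In the manner of
Dreyfus and Wagner, every `lstar` value with `I` nonempty is built by attaching edges and joining
trees at their root (`derives_lstar`), and the pieces of an optimal derivation of a splitting tuple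
split again. If no exact splitting tuple were queued, all of them, including `(r, R \ {r})`, would
be exact, and the latter would be expanded. So until then the queue holds an exact splitting tuple,
whose estimate is at most `csmt N R` by admissibility. The queue is thus nonempty, and `(r, R \
{r})`, when chosen, has a label at most `csmt N R`; labels never underestimate.

The heuristic need not be consistent, so tuples may be expanded repeatedly. Termination comes from
the lexicographic decrease of the labels and then the queue size. -/

namespace DSStar

/-! ### Reachability in finite edge sets -/

section EdgeSets

variable {V : Type*}

/-- Reachability along the edges of a finite edge set. -/
def EdgeReach (E : Finset (Sym2 V)) : V → V → Prop :=
  Relation.ReflTransGen fun a b => s(a, b) ∈ E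

theorem EdgeReach.symm {E : Finset (Sym2 V)} {a b : V} (h : EdgeReach E a b) :
    EdgeReach E b a := by
  have : Std.Symm fun a b => s(a, b) ∈ E := ⟨fun x y hxy => by rwa [Sym2.eq_swap]⟩
  exact Relation.ReflTransGen.stdSymm.symm _ _ h

theorem EdgeReach.trans {E : Finset (Sym2 V)} {a b c : V} (h : EdgeReach E a b)
    (h' : EdgeReach E b c) : EdgeReach E a c :=
  Relation.ReflTransGen.trans h h'

theorem EdgeReach.mono {E F : Finset (Sym2 V)} (hEF : E ⊆ F) {a b : V}
    (h : EdgeReach E a b) : EdgeReach F a b :=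
  Relation.ReflTransGen.mono (fun _ _ hab => hEF hab) _ _ h

theorem sum_union_le {α : Type*} [DecidableEq α] (f : α → ℕ) (E F : Finset α) :
    ∑ e ∈ E ∪ F, f e ≤ ∑ e ∈ E, f e + ∑ e ∈ F, f e := by
  rw [← Finset.sum_union_inter]
  exact Nat.le_add_right _ _

theorem EdgeReach.erase [DecidableEq V] {E : Finset (Sym2 V)} {u w x : V}
    (h : EdgeReach E u x) :
    EdgeReach (E.erase s(u, w)) u x ∨ EdgeReach (E.erase s(u, w)) w x := by
  induction h with
  | refl => exact Or.inl .refl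
  | @tail b c _ hbc ih =>
    by_cases he : s(b, c) = s(u, w)
    · rcases Sym2.eq_iff.1 he with ⟨-, rfl⟩ | ⟨-, rfl⟩
      · exact Or.inr .refl
      · exact Or.inl .refl
    · have hmem : s(b, c) ∈ E.erase s(u, w) := Finset.mem_erase.2 ⟨he, hbc⟩
      exact ih.imp (fun h => h.tail hmem) (fun h => h.tail hmem)

open Classical in
theorem EdgeReach.filter_touching {E : Finset (Sym2 V)} {u x : V} (h : EdgeReach E u x) :
    EdgeReach (E.filter fun e => ∃ a ∈ e, EdgeReach E u a) u x := by
  induction h with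
  | refl => exact .refl
  | @tail b c hb hbc ih =>
    exact ih.tail (Finset.mem_filter.2 ⟨hbc, b, Sym2.mem_mk_left b c, hb⟩)

open Classical in
theorem EdgeReach.filter_not_touching {E : Finset (Sym2 V)} {u w x : V}
    (h : EdgeReach E w x) (hx : ¬ EdgeReach E u x) :
    EdgeReach (E.filter fun e => ¬ ∃ a ∈ e, EdgeReach E u a) w x := by
  induction h using Relation.ReflTransGen.head_induction_on with
  | refl => exact .refl
  | @head a b hab hb ih =>
    refine Relation.ReflTransGen.head (Finset.mem_filter.2 ⟨hab, ?_⟩) ih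
    rintro ⟨a', ha', hu⟩
    rcases Sym2.mem_iff.1 ha' with rfl | rfl
    · exact hx (hu.trans (.head hab hb))
    · exact hx (hu.trans hb)

end EdgeSets

/-! ### Building trees by edge attachment and joining -/

section Derivations

variable {V : Type*} [DecidableEq V] (N : Network V)

/-- Costs that are obtained from trivial trees by attaching an edge at the root, and by joining
two trees with the same root and disjoint terminal sets. -/
inductive Derives : V → Finset V → ℕ → Prop
  | base (u : V) : Derives u {u} 0
  | propagate {u v : V} {I : Finset V} {c : ℕ} (huv : N.graph.Adj u v) (h : Derives u I c) :
      Derives v I (c + N.cost s(u, v))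
  | combine {u : V} {I J : Finset V} {c d : ℕ} (hIJ : Disjoint I J) (hI : Derives u I c)
      (hJ : Derives u J d) : Derives u (I ∪ J) (c + d)

variable {N}

theorem Derives.nonempty {u : V} {I : Finset V} {c : ℕ} (h : Derives N u I c) :
    I.Nonempty := by
  induction h with
  | base u => exact Finset.singleton_nonempty u
  | propagate _ _ ih => exact ih
  | combine _ _ _ ih _ => exact ih.mono Finset.subset_union_left

/-- Induction on `E`, which may contain cycles. Delete an edge `uw`: terminals still reachable from
`u` stay at `u`; all others are reached from `w` by edges not touching the component of `u`. The two
edge sets are disjoint, so the costs add up. -/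
theorem exists_derives_of_edgeReach (E : Finset (Sym2 V)) :
    (∀ e ∈ E, e ∈ N.graph.edgeSet) → ∀ (u : V) (I : Finset V), I.Nonempty →
      (∀ x ∈ I, EdgeReach E u x) → ∃ c ≤ ∑ e ∈ E, N.cost e, Derives N u I c := by
  classical
  induction E using Finset.strongInduction with
  | H E ih =>
  intro hE u I hne hI
  by_cases h : ∃ w, s(u, w) ∈ E
  · obtain ⟨w, hw⟩ := h
    set E' := E.erase s(u, w) with hE'
    have hss : E' ⊂ E := Finset.erase_ssubset hw
    set EA := E'.filter fun e => ∃ a ∈ e, EdgeReach E' u a with hEA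
    set EB := E'.filter fun e => ¬ ∃ a ∈ e, EdgeReach E' u a with hEB
    set IA := I.filter fun x => EdgeReach E' u x with hIA
    set IB := I.filter fun x => ¬ EdgeReach E' u x with hIB
    have hsum : ∑ e ∈ E, N.cost e =
        ∑ e ∈ EA, N.cost e + (∑ e ∈ EB, N.cost e + N.cost s(u, w)) := by
      rw [← Finset.sum_erase_add E _ hw, ← add_assoc, Finset.sum_filter_add_sum_filter_not]
    have hunion : IA ∪ IB = I := Finset.filter_union_filter_not_eq _ I
    have hdisj : Disjoint IA IB := Finset.disjoint_filter_filter_not I I _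
    have hA : IA.Nonempty → ∃ c ≤ ∑ e ∈ EA, N.cost e, Derives N u IA c := fun hn =>
      ih EA ((Finset.filter_subset _ _).trans_ssubset hss)
        (fun e he => hE e (hss.1 (Finset.filter_subset _ _ he))) u IA hn
        (fun x hx => (Finset.mem_filter.1 hx).2.filter_touching)
    have hB : IB.Nonempty → ∃ c ≤ ∑ e ∈ EB, N.cost e + N.cost s(u, w), Derives N u IB c := by
      intro hn
      obtain ⟨c, hc, hd⟩ := ih EB ((Finset.filter_subset _ _).trans_ssubset hss)
        (fun e he => hE e (hss.1 (Finset.filter_subset _ _ he))) w IB hn (fun x hx => by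
          obtain ⟨hxI, hx'⟩ := Finset.mem_filter.1 hx
          exact ((hI x hxI).erase.resolve_left hx').filter_not_touching hx')
      have hadj : N.graph.Adj w u := (show N.graph.Adj u w from hE _ hw).symm
      refine ⟨_, Nat.add_le_add_right hc _, ?_⟩
      rw [Sym2.eq_swap]
      exact .propagate hadj hd
    rcases IA.eq_empty_or_nonempty with hAe | hAn
    · rw [hAe, Finset.empty_union] at hunion
      obtain ⟨c, hc, hd⟩ := hB (hunion ▸ hne)
      exact ⟨c, by omega, hunion ▸ hd⟩
    · obtain ⟨c, hc, hd⟩ := hA hAn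
      rcases IB.eq_empty_or_nonempty with hBe | hBn
      · rw [hBe, Finset.union_empty] at hunion
        exact ⟨c, by omega, hunion ▸ hd⟩
      · obtain ⟨c', hc', hd'⟩ := hB hBn
        exact ⟨c + c', by omega, hunion ▸ .combine hdisj hd hd'⟩
  · have hIu : I = {u} := by
      refine Finset.eq_singleton_iff_nonempty_unique_mem.2 ⟨hne, fun x hx => ?_⟩
      rcases Relation.ReflTransGen.cases_head (hI x hx) with h' | ⟨w, hw, -⟩
      · exact h'.symm
      · exact absurd ⟨w, hw⟩ h
    exact ⟨0, Nat.zero_le _, hIu ▸ .base u⟩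

end Derivations

/-! ### Edge sets versus Steiner trees -/

section Costs

variable {V : Type*} [Finite V] (N : Network V)

/-- Take a spanning tree of the component of `u` in `E`. This allows unions of edge sets to be used
without removing cycles by hand. -/
theorem exists_isSteinerTree_of_edgeReach [DecidableEq V] {E : Finset (Sym2 V)}
    (hE : ∀ e ∈ E, e ∈ N.graph.edgeSet) {u : V} {A : Finset V}
    (hA : ∀ x ∈ A, EdgeReach E u x) :
    ∃ T : N.graph.Subgraph, IsSteinerTree N (A ∪ {u}) T ∧
      subgraphCost N T ≤ ∑ e ∈ E, N.cost e := by
  let G : SimpleGraph {x // EdgeReach E u x} :=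
    { Adj := fun a b => s(a.1, b.1) ∈ E
      symm := ⟨fun a b h => by rwa [Sym2.eq_swap]⟩
      loopless := ⟨fun a h => N.graph.irrefl (hE _ h)⟩ }
  have hG : G.Connected := by
    have key : ∀ (x : V) (hx : EdgeReach E u x), G.Reachable ⟨u, .refl⟩ ⟨x, hx⟩ := by
      intro x hx
      induction hx with
      | refl => exact .refl _
      | @tail b c hb hbc ih =>
        exact ih.trans (SimpleGraph.Adj.reachable (G := G) (u := ⟨b, hb⟩) hbc)
    have : Nonempty {x // EdgeReach E u x} := ⟨⟨u, .refl⟩⟩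
    exact ⟨fun a b => (key a.1 a.2).symm.trans (key b.1 b.2)⟩
  obtain ⟨T, hTG, hT⟩ := hG.exists_isTree_le
  let T' : N.graph.Subgraph :=
    { verts := {x | EdgeReach E u x}
      Adj := fun a b => ∃ (ha : EdgeReach E u a) (hb : EdgeReach E u b), T.Adj ⟨a, ha⟩ ⟨b, hb⟩
      adj_sub := by
        rintro a b ⟨_, _, h⟩
        exact hE _ (hTG h)
      edge_vert := fun h => h.1
      symm := ⟨fun _ _ h => ⟨h.2.1, h.1, h.2.2.symm⟩⟩ }
  have hcoe : T'.coe = T := by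
    ext a b
    exact ⟨fun h => h.2.2, fun h => ⟨a.2, b.2, h⟩⟩
  refine ⟨T', ⟨by rw [hcoe]; exact hT, ?_⟩, ?_⟩
  · intro x hx
    rcases Finset.mem_union.1 (Finset.mem_coe.1 hx) with hx | hx
    · exact hA x hx
    · rw [Finset.mem_singleton.1 hx]; exact Relation.ReflTransGen.refl
  · refine Finset.sum_le_sum_of_subset fun e he => ?_
    rw [Set.Finite.mem_toFinset] at he
    induction e with
    | _ a b =>
      obtain ⟨_, _, h⟩ := (SimpleGraph.Subgraph.mem_edgeSet).1 he
      exact hTG h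

theorem edgeReach_of_connected {H : N.graph.Subgraph} (hH : H.coe.Connected) {x y : V}
    (hx : x ∈ H.verts) (hy : y ∈ H.verts) :
    EdgeReach (Set.toFinite H.edgeSet).toFinset x y := by
  obtain ⟨p⟩ := hH.preconnected ⟨x, hx⟩ ⟨y, hy⟩
  have key : ∀ a b : H.verts, H.coe.Walk a b →
      EdgeReach (Set.toFinite H.edgeSet).toFinset a.1 b.1 := by
    intro a b p
    induction p with
    | nil => exact .refl
    | cons h _ ih => exact .head (by simpa using h) ih
  exact key _ _ p

theorem exists_edges_univ [DecidableEq V] (u : V) (A : Finset V) : ∃ E : Finset (Sym2 V),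
    (∀ e ∈ E, e ∈ N.graph.edgeSet) ∧ ∀ x ∈ A, EdgeReach E u x := by
  refine ⟨(Set.toFinite N.graph.edgeSet).toFinset, by simp, fun x hx => ?_⟩
  clear hx
  obtain ⟨p⟩ := N.connected.preconnected u x
  induction p with
  | nil => exact .refl
  | cons h _ ih => exact .head (by simpa using h) ih

theorem exists_isSteinerTree_cost_eq_csmt {A : Finset V} (hA : A.Nonempty) :
    ∃ T : N.graph.Subgraph, IsSteinerTree N A T ∧ subgraphCost N T = csmt N A := by
  classical
  obtain ⟨u, hu⟩ := hA
  obtain ⟨E, hE, hr⟩ := exists_edges_univ N u A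
  obtain ⟨T, hT, -⟩ := exists_isSteinerTree_of_edgeReach N hE hr
  rw [Finset.union_eq_left.2 (Finset.singleton_subset_iff.2 hu)] at hT
  exact Nat.sInf_mem (s := {c | ∃ T, IsSteinerTree N A T ∧ subgraphCost N T = c}) ⟨_, T, hT, rfl⟩

theorem exists_isSMT {A : Finset V} (hA : A.Nonempty) :
    ∃ T : N.graph.Subgraph, IsSMT N A T ∧ subgraphCost N T = csmt N A := by
  obtain ⟨T, hT, hc⟩ := exists_isSteinerTree_cost_eq_csmt N hA
  exact ⟨T, ⟨hT, fun T' hT' => hc.trans_le (Nat.sInf_le ⟨T', hT', rfl⟩)⟩, hc⟩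

theorem csmt_mono {A B : Finset V} (hAB : A ⊆ B) (hB : B.Nonempty) : csmt N A ≤ csmt N B := by
  obtain ⟨T, hT, hc⟩ := exists_isSteinerTree_cost_eq_csmt N hB
  rw [← hc]
  exact Nat.sInf_le ⟨T, ⟨hT.1, (Finset.coe_subset.2 hAB).trans hT.2⟩, rfl⟩

theorem exists_edges_netDist (x y : V) : ∃ E : Finset (Sym2 V),
    (∀ e ∈ E, e ∈ N.graph.edgeSet) ∧ ∑ e ∈ E, N.cost e = netDist N x y ∧ EdgeReach E x y := by
  classical
  obtain ⟨H, hH, hx, hy, hc⟩ : netDist N x y ∈ {c | ∃ H : N.graph.Subgraph, H.Connected ∧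
      x ∈ H.verts ∧ y ∈ H.verts ∧ subgraphCost N H = c} := by
    refine Nat.sInf_mem ?_
    obtain ⟨T, hT, -⟩ := exists_isSteinerTree_cost_eq_csmt N (A := {x, y})
      (Finset.insert_nonempty x {y})
    exact ⟨_, T, ⟨hT.1.connected⟩, hT.2 (by simp), hT.2 (by simp), rfl⟩
  refine ⟨(Set.toFinite H.edgeSet).toFinset, fun e he => ?_, hc,
    edgeReach_of_connected N hH.coe hx hy⟩
  exact H.edgeSet_subset ((Set.Finite.mem_toFinset _).1 he)

variable [DecidableEq V]

theorem lstar_le {E : Finset (Sym2 V)} (hE : ∀ e ∈ E, e ∈ N.graph.edgeSet) {u : V}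
    {A : Finset V} (hA : ∀ x ∈ A, EdgeReach E u x) : lstar N u A ≤ ∑ e ∈ E, N.cost e := by
  obtain ⟨T, hT, hc⟩ := exists_isSteinerTree_of_edgeReach N hE hA
  exact le_trans (Nat.sInf_le ⟨T, hT, rfl⟩) hc

theorem exists_edges_lstar (u : V) (A : Finset V) : ∃ E : Finset (Sym2 V),
    (∀ e ∈ E, e ∈ N.graph.edgeSet) ∧ ∑ e ∈ E, N.cost e = lstar N u A ∧
      ∀ x ∈ A, EdgeReach E u x := by
  obtain ⟨T, hT, hc⟩ := exists_isSteinerTree_cost_eq_csmt N (A := A ∪ {u})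
    ⟨u, Finset.mem_union_right _ (Finset.mem_singleton_self u)⟩
  refine ⟨(Set.toFinite T.edgeSet).toFinset, fun e he => ?_, hc, fun x hx => ?_⟩
  · exact T.edgeSet_subset ((Set.Finite.mem_toFinset _).1 he)
  · exact edgeReach_of_connected N hT.1.connected (hT.2 (by simp)) (hT.2 (by simp [hx]))

theorem lstar_union_le (u : V) (I J : Finset V) :
    lstar N u (I ∪ J) ≤ lstar N u I + lstar N u J := by
  obtain ⟨E, hE, hc, hI⟩ := exists_edges_lstar N u I
  obtain ⟨F, hF, hd, hJ⟩ := exists_edges_lstar N u J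
  rw [← hc, ← hd]
  refine (lstar_le N (E := E ∪ F) ?_ ?_).trans (sum_union_le _ E F)
  · intro e he
    exact (Finset.mem_union.1 he).elim (hE e) (hF e)
  · intro x hx
    exact (Finset.mem_union.1 hx).elim (fun h => (hI x h).mono Finset.subset_union_left)
      (fun h => (hJ x h).mono Finset.subset_union_right)

theorem lstar_le_of_adj {u v : V} (huv : N.graph.Adj u v) (I : Finset V) :
    lstar N v I ≤ lstar N u I + N.cost s(u, v) := by
  obtain ⟨E, hE, hc, hI⟩ := exists_edges_lstar N u I
  have := sum_union_le N.cost E {s(u, v)}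
  rw [Finset.sum_singleton, hc] at this
  refine (lstar_le N (E := E ∪ {s(u, v)}) ?_ ?_).trans this
  · intro e he
    rcases Finset.mem_union.1 he with h | h
    · exact hE e h
    · rw [Finset.mem_singleton.1 h]; exact huv
  · intro x hx
    exact .head (by simp [Sym2.eq_swap]) ((hI x hx).mono Finset.subset_union_left)

theorem lstar_self (u : V) : lstar N u {u} = 0 :=
  Nat.le_zero.1 <| by
    simpa using lstar_le N (E := ∅) (by simp) (u := u) (A := {u})
      (fun x hx => by rw [Finset.mem_singleton.1 hx]; exact .refl)

theorem lstar_empty (u : V) : lstar N u ∅ = 0 :=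
  Nat.le_zero.1 <| by simpa using lstar_le N (E := ∅) (by simp) (u := u) (A := ∅) (by simp)

variable {N}

theorem Derives.lstar_le {u : V} {I : Finset V} {c : ℕ} (h : Derives N u I c) :
    lstar N u I ≤ c := by
  induction h with
  | base u => exact (lstar_self N u).le
  | propagate huv _ ih => exact (lstar_le_of_adj N huv _).trans (Nat.add_le_add_right ih _)
  | combine _ _ _ ih ih' => exact (lstar_union_le N _ _ _).trans (Nat.add_le_add ih ih')

/-- The edges of an optimal tree give a derivation of no larger cost, and no derivation costs less
than `lstar`. -/
theorem derives_lstar (u : V) {I : Finset V} (hI : I.Nonempty) :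
    Derives N u I (lstar N u I) := by
  obtain ⟨E, hE, hc, hr⟩ := exists_edges_lstar N u I
  obtain ⟨c, hle, hd⟩ := exists_derives_of_edgeReach E hE u I hI hr
  rwa [← le_antisymm (hle.trans hc.le) hd.lstar_le]

end Costs

/-! ### Set distances -/

section Distances

variable {V : Type*} [Finite V] {N : Network V}

theorem exists_setDist_eq {A B : Finset V} (h : setDist N A B ≠ ⊤) :
    ∃ x ∈ A, ∃ y ∈ B, setDist N A B = netDist N x y := by
  have hA : A.Nonempty := by
    rw [Finset.nonempty_iff_ne_empty]
    rintro rfl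
    simp [setDist] at h
  have hB : B.Nonempty := by
    rw [Finset.nonempty_iff_ne_empty]
    rintro rfl
    simp [setDist] at h
  have hs : setDist N A B = A.inf fun x => B.inf fun y => (netDist N x y : ℕ∞) := by
    simp only [setDist, Finset.inf_eq_iInf]
  obtain ⟨x, hx, hx'⟩ :=
    Finset.exists_mem_eq_inf A hA fun x => B.inf fun y => (netDist N x y : ℕ∞)
  obtain ⟨y, hy, hy'⟩ := Finset.exists_mem_eq_inf B hB fun y => (netDist N x y : ℕ∞)
  exact ⟨x, hx, y, hy, by rw [hs, hx', hy']⟩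

theorem setDist_anti {A B C : Finset V} (hBC : B ⊆ C) : setDist N A C ≤ setDist N A B :=
  iInf₂_mono fun _ _ => biInf_mono fun _ h => hBC h

theorem setDist_le {A B : Finset V} {x y : V} (hx : x ∈ A) (hy : y ∈ B) :
    setDist N A B ≤ netDist N x y :=
  (iInf₂_le x hx).trans (iInf₂_le y hy)

end Distances

/-! ### Validity of the pruning bounds -/

section Bounds

variable {V : Type*} [DecidableEq V] (N : Network V) (R : Finset V)

/-- Every defined bound `U(J)` is witnessed by edges that connect each vertex of `J` to a vertex
of `S(J) ⊆ R \ J`. -/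
def BoundsValid (U : Finset V → ℕ∞) (S : Finset V → Finset V) : Prop :=
  ∀ J, U J ≠ ⊤ → ∃ E : Finset (Sym2 V), (∀ e ∈ E, e ∈ N.graph.edgeSet) ∧
    ((∑ e ∈ E, N.cost e : ℕ) : ℕ∞) ≤ U J ∧ S J ⊆ R \ J ∧
    ∀ x ∈ J, ∃ z ∈ S J, EdgeReach E x z

variable {N R}

theorem BoundsValid.update {U : Finset V → ℕ∞} {S : Finset V → Finset V}
    (hU : BoundsValid N R U S) {J : Finset V} {c : ℕ∞} {A : Finset V}
    {E : Finset (Sym2 V)} (hE : ∀ e ∈ E, e ∈ N.graph.edgeSet)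
    (hc : ((∑ e ∈ E, N.cost e : ℕ) : ℕ∞) ≤ c) (hA : A ⊆ R \ J)
    (hr : ∀ x ∈ J, ∃ z ∈ A, EdgeReach E x z) :
    BoundsValid N R (Function.update U J c) (Function.update S J A) := by
  intro K hK
  by_cases hKJ : K = J
  · subst hKJ
    simp only [Function.update_self]
    exact ⟨E, hE, hc, hA, hr⟩
  · simp only [Function.update_of_ne hKJ] at hK ⊢
    exact hU K hK

/-- The union of the two witnessing edge sets is a witness; it need not be connected. The new bound
may exceed the old one, but only validity matters. -/
theorem combineBounds_spec {J₁ J₂ : Finset V} {s : State V}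
    (hs : BoundsValid N R s.U s.S) :
    BoundsValid N R (combineBounds J₁ J₂ s).U (combineBounds J₁ J₂ s).S ∧
      (combineBounds J₁ J₂ s).l = s.l ∧ (combineBounds J₁ J₂ s).b = s.b ∧
      (combineBounds J₁ J₂ s).Q = s.Q ∧ (combineBounds J₁ J₂ s).P = s.P := by
  unfold combineBounds
  split_ifs with h
  · refine ⟨?_, rfl, rfl, rfl, rfl⟩
    obtain ⟨h₁, h₂, hS⟩ := h
    obtain ⟨E, hE, hcE, hSE, hrE⟩ := hs J₁ h₁
    obtain ⟨F, hF, hcF, hSF, hrF⟩ := hs J₂ h₂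
    refine hs.update (E := E ∪ F) (fun e he => (Finset.mem_union.1 he).elim (hE e) (hF e)) ?_
      ?_ ?_
    · refine (Nat.cast_le.2 (sum_union_le N.cost E F)).trans ?_
      rw [Nat.cast_add]
      exact add_le_add hcE hcF
    · intro z hz
      obtain ⟨hz, hz'⟩ := Finset.mem_sdiff.1 hz
      refine Finset.mem_sdiff.2 ⟨?_, hz'⟩
      exact (Finset.mem_union.1 hz).elim (fun h => (Finset.mem_sdiff.1 (hSE h)).1)
        (fun h => (Finset.mem_sdiff.1 (hSF h)).1)
    · have hrE' : ∀ x ∈ J₁, ∃ z ∈ s.S J₁, z ∉ J₁ ∧ EdgeReach (E ∪ F) x z := fun x hx => by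
        obtain ⟨z, hz, hxz⟩ := hrE x hx
        exact ⟨z, hz, (Finset.mem_sdiff.1 (hSE hz)).2, hxz.mono Finset.subset_union_left⟩
      have hrF' : ∀ x ∈ J₂, ∃ z ∈ s.S J₂, z ∉ J₂ ∧ EdgeReach (E ∪ F) x z := fun x hx => by
        obtain ⟨z, hz, hxz⟩ := hrF x hx
        exact ⟨z, hz, (Finset.mem_sdiff.1 (hSF hz)).2, hxz.mono Finset.subset_union_right⟩
      have key : ∀ {K₁ K₂ : Finset V}, s.S K₁ ∩ K₂ = ∅ →
          (∀ x ∈ K₁, ∃ z ∈ s.S K₁, z ∉ K₁ ∧ EdgeReach (E ∪ F) x z) →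
          (∀ x ∈ K₂, ∃ z ∈ s.S K₂, z ∉ K₂ ∧ EdgeReach (E ∪ F) x z) →
          ∀ x, x ∈ K₁ ∨ x ∈ K₂ → ∃ z, (z ∈ s.S K₁ ∨ z ∈ s.S K₂) ∧ z ∉ K₁ ∧ z ∉ K₂ ∧
            EdgeReach (E ∪ F) x z := by
        intro K₁ K₂ hK r₁ r₂
        have first : ∀ x ∈ K₁, ∃ z, (z ∈ s.S K₁ ∨ z ∈ s.S K₂) ∧ z ∉ K₁ ∧ z ∉ K₂ ∧
            EdgeReach (E ∪ F) x z := fun x hx => by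
          obtain ⟨z, hz, hz', hxz⟩ := r₁ x hx
          refine ⟨z, Or.inl hz, hz', fun hzK => ?_, hxz⟩
          exact Finset.notMem_empty z (hK ▸ Finset.mem_inter.2 ⟨hz, hzK⟩)
        rintro x (hx | hx)
        · exact first x hx
        · obtain ⟨z, hz, hz', hxz⟩ := r₂ x hx
          -- A connection from `K₂` that ends inside `K₁` is prolonged by one from `K₁`, which ends
          -- outside both sets.
          by_cases hzK : z ∈ K₁
          · obtain ⟨z', h1, h2, h3, h4⟩ := first z hzK
            exact ⟨z', h1, h2, h3, hxz.trans h4⟩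
          · exact ⟨z, Or.inr hz, hzK, hz', hxz⟩
      intro x hx
      rcases hS with hS | hS
      · obtain ⟨z, h1, h2, h3, h4⟩ := key hS hrE' hrF' x (Finset.mem_union.1 hx)
        exact ⟨z, by simp [h1, h2, h3], h4⟩
      · obtain ⟨z, h1, h2, h3, h4⟩ := key hS hrF' hrE' x (Finset.mem_union.1 hx).symm
        exact ⟨z, by simp [h1.symm, h2, h3], h4⟩
  · exact ⟨hs, rfl, rfl, rfl, rfl⟩

end Bounds

/-! ### Invariants within one iteration -/

section Invariants

variable {V : Type*} [Finite V] [DecidableEq V] (N : Network V) (R : Finset V) (r : V)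

/-- The tuple `x` splits a Steiner minimal tree for `(N, R)`: a minimal tree for `x` and a minimal
tree for the remaining terminals, joined at the vertex of `x`, cost no more than `csmt(N, R)`. -/
def Splits (x : Tuple V) : Prop :=
  x.2.Nonempty ∧ x.2 ⊆ R \ {r} ∧ lstar N x.1 x.2 + lstar N x.1 (R \ x.2) ≤ csmt N R

/-- The tentative cost of `x` has its final value. -/
def Tight (s : State V) (x : Tuple V) : Prop :=
  s.l x = (lstar N x.1 x.2 : ℕ∞)

/-- The relation between the states before and after a part of an iteration. -/
structure Evolves (s t : State V) : Prop where
  l_le : ∀ x, t.l x ≤ s.l x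
  P_eq : t.P = s.P
  Q_subset : s.Q ⊆ t.Q
  Q_eq : t.l = s.l → t.Q = s.Q
  tight : ∀ x, Splits N R r x → Tight N t x → Tight N s x ∨ x ∈ t.Q

/-- The invariants that hold throughout the execution. -/
structure Inv (s : State V) : Prop where
  lstar_le : ∀ x : Tuple V, (lstar N x.1 x.2 : ℕ∞) ≤ s.l x
  bounds : BoundsValid N R s.U s.S
  queue : ∀ x ∈ s.Q, x.2.Nonempty ∧ x.2 ⊆ R \ {r}
  retrace : ∀ x, ∀ z ∈ s.b x, z.2 ⊂ x.2 ∨ z.2 = x.2 ∧ s.l z < s.l x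

variable {N R r}

theorem Evolves.refl (s : State V) : Evolves N R r s s :=
  ⟨fun _ => le_rfl, rfl, subset_rfl, fun _ => rfl, fun _ _ h => Or.inl h⟩

theorem Evolves.trans {s m t : State V} (h : Evolves N R r s m) (h' : Evolves N R r m t) :
    Evolves N R r s t where
  l_le x := (h'.l_le x).trans (h.l_le x)
  P_eq := h'.P_eq.trans h.P_eq
  Q_subset := h.Q_subset.trans h'.Q_subset
  Q_eq hl := by
    have hm : m.l = s.l := funext fun x => le_antisymm (h.l_le x) (hl ▸ h'.l_le x)
    rw [h'.Q_eq (hl.trans hm.symm), h.Q_eq hm]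
  tight x hx ht := by
    rcases h'.tight x hx ht with hm | hQ
    · exact (h.tight x hx hm).imp_right fun hQ => h'.Q_subset hQ
    · exact Or.inr hQ

theorem csmt_le_lstar (u : V) {A : Finset V} : csmt N A ≤ lstar N u A :=
  csmt_mono N Finset.subset_union_left
    ⟨u, Finset.mem_union_right _ (Finset.mem_singleton_self u)⟩

theorem BoundsValid.lstar_le {U : Finset V → ℕ∞} {S : Finset V → Finset V}
    (hU : BoundsValid N R U S) {u : V} {I : Finset V} (hI : Splits N R r (u, I)) :
    (lstar N u I : ℕ∞) ≤ U I := by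
  by_cases htop : U I = ⊤
  · simp [htop]
  obtain ⟨E, hE, hc, hS, hr⟩ := hU I htop
  obtain ⟨F, hF, hd, hr'⟩ := exists_edges_lstar N u (R \ I)
  refine le_trans (Nat.cast_le.2 ?_) hc
  -- `E` leads each terminal in `I` to one outside `I`, and `F` joins all of those to `u`.
  have h1 : csmt N R ≤ ∑ e ∈ E ∪ F, N.cost e := by
    refine (csmt_le_lstar u).trans (DSStar.lstar_le N (fun e he =>
      (Finset.mem_union.1 he).elim (hE e) (hF e)) fun x hx => ?_)
    by_cases hxI : x ∈ I
    · obtain ⟨z, hz, hxz⟩ := hr x hxI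
      exact ((hr' z (hS hz)).mono Finset.subset_union_right).trans
        (hxz.symm.mono Finset.subset_union_left)
    · exact (hr' x (Finset.mem_sdiff.2 ⟨hx, hxI⟩)).mono Finset.subset_union_right
  have h2 := sum_union_le N.cost E F
  have h3 := hI.2.2
  simp only at h3
  omega

/-- The new bound pays for an optimal tree for `(v, J)`, by `hl`, and for a shortest connection from
some `y ∈ J ∪ {v}` of that tree to `z`. -/
theorem UpdateBound.spec {v : V} {J : Finset V} {s t : State V}
    (h : UpdateBound N R v J s t) (hl : (lstar N v J : ℕ∞) ≤ s.l (v, J))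
    (hs : BoundsValid N R s.U s.S) :
    BoundsValid N R t.U t.S ∧ t.l = s.l ∧ t.b = s.b ∧ t.Q = s.Q ∧ t.P = s.P := by
  rcases h with ⟨-, rfl⟩ | ⟨hlt, z, hz, hD, rfl⟩
  · exact ⟨hs, rfl, rfl, rfl, rfl⟩
  refine ⟨?_, rfl, rfl, rfl, rfl⟩
  set D := min (setDist N J (R \ J)) (setDist N {v} (R \ J)) with hDdef
  have hDtop : D ≠ ⊤ := by
    intro hD
    simp [hD] at hlt
  obtain ⟨y, hy, hyD⟩ : ∃ y ∈ J ∪ {v}, D = netDist N y z := by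
    rcases min_choice (setDist N J {z}) (setDist N {v} {z}) with hm | hm <;> rw [hm] at hD
    all_goals
      obtain ⟨y, hy, z', hz', he⟩ := exists_setDist_eq (hD ▸ hDtop)
      obtain rfl := Finset.mem_singleton.1 hz'
      exact ⟨y, by simp only [Finset.mem_union]; tauto, hD.symm.trans he⟩
  obtain ⟨E, hE, hc, hr⟩ := exists_edges_lstar N v J
  obtain ⟨F, hF, hd, hyz⟩ := exists_edges_netDist N y z
  refine hs.update (E := E ∪ F) (fun e he => (Finset.mem_union.1 he).elim (hE e) (hF e)) ?_
    (Finset.singleton_subset_iff.2 hz) fun x hx => ⟨z, Finset.mem_singleton_self z, ?_⟩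
  · refine (Nat.cast_le.2 (sum_union_le N.cost E F)).trans ?_
    rw [hc, hd, Nat.cast_add, ← hyD]
    gcongr
  · have hvy : EdgeReach E v y := by
      rcases Finset.mem_union.1 hy with hy | hy
      · exact hr y hy
      · rw [Finset.mem_singleton.1 hy]; exact Relation.ReflTransGen.refl
    exact (((hr x hx).symm.trans hvy).mono Finset.subset_union_left).trans
      (hyz.mono Finset.subset_union_right)

theorem exists_updateBound (v : V) (J : Finset V) (s : State V) :
    ∃ t, UpdateBound N R v J s t := by
  by_cases hle : s.U J ≤ s.l (v, J) + min (setDist N J (R \ J)) (setDist N {v} (R \ J))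
  · exact ⟨s, Or.inl ⟨hle, rfl⟩⟩
  have hlt := not_le.1 hle
  set D := min (setDist N J (R \ J)) (setDist N {v} (R \ J)) with hDdef
  have hDtop : D ≠ ⊤ := by
    intro hD
    simp [hD] at hlt
  have key : ∀ z ∈ R \ J, D ≤ min (setDist N J {z}) (setDist N {v} {z}) := fun z hz =>
    min_le_min (setDist_anti (Finset.singleton_subset_iff.2 hz))
      (setDist_anti (Finset.singleton_subset_iff.2 hz))
  obtain ⟨z, hz, hzD⟩ : ∃ z ∈ R \ J, min (setDist N J {z}) (setDist N {v} {z}) ≤ D := by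
    rcases min_choice (setDist N J (R \ J)) (setDist N {v} (R \ J)) with hm | hm
    · have hm' := hDdef.trans hm
      obtain ⟨y, hy, z, hz, he⟩ := exists_setDist_eq (hm' ▸ hDtop)
      refine ⟨z, hz, (min_le_left _ _).trans ?_⟩
      rw [hm', he]
      exact setDist_le hy (Finset.mem_singleton_self z)
    · have hm' := hDdef.trans hm
      obtain ⟨y, hy, z, hz, he⟩ := exists_setDist_eq (hm' ▸ hDtop)
      refine ⟨z, hz, (min_le_right _ _).trans ?_⟩
      rw [hm', he]
      exact setDist_le hy (Finset.mem_singleton_self z)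
  exact ⟨_, Or.inr ⟨hlt, z, hz, le_antisymm hzD (key z hz), rfl⟩⟩

/-- Common core of both loop bodies, with `m` the state after the pruning call. The hypothesis
`hans` is all that is asked of the answer: never drop a splitting tuple with exact label. -/
theorem Inv.relax {s m t : State V} (hs : Inv N R r s) {x : Tuple V} {c : ℕ∞}
    {B : Finset (Tuple V)} (hx : x.2.Nonempty ∧ x.2 ⊆ R \ {r}) (hc : c < s.l x)
    (hlc : (lstar N x.1 x.2 : ℕ∞) ≤ c) (hB : ∀ z ∈ B, z.2 ⊂ x.2 ∨ z.2 = x.2 ∧ s.l z < c)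
    (hm : BoundsValid N R m.U m.S) (hml : m.l = (s.assign x c B).l)
    (hmb : m.b = (s.assign x c B).b) (hmQ : m.Q = s.Q) (hmP : m.P = s.P) {ans : Bool}
    (hans : Splits N R r x → c = lstar N x.1 x.2 → ans = false)
    (ht : t = if ans then m else m.push x) :
    Inv N R r t ∧ Evolves N R r s t ∧ t.l x ≤ c := by
  have htl : t.l = Function.update s.l x c := by rw [ht]; split_ifs <;> exact hml
  have htb : t.b = Function.update s.b x B := by rw [ht]; split_ifs <;> exact hmb
  have htP : t.P = s.P := by rw [ht]; split_ifs <;> exact hmP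
  have htU : BoundsValid N R t.U t.S := by rw [ht]; split_ifs <;> exact hm
  have hQ : s.Q ⊆ t.Q := by
    rw [ht, ← hmQ]
    split_ifs
    · rfl
    · exact Finset.subset_union_left
  have hQ' : t.Q ⊆ s.Q ∪ {x} := by
    rw [ht, ← hmQ]
    split_ifs
    · exact Finset.subset_union_left
    · rfl
  have hlx : t.l x = c := by rw [htl, Function.update_self]
  have hly : ∀ y, y ≠ x → t.l y = s.l y := fun y hy => by rw [htl, Function.update_of_ne hy]
  have hle : ∀ y, t.l y ≤ s.l y := fun y => by
    by_cases hy : y = x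
    · rw [hy, hlx]; exact hc.le
    · exact (hly y hy).le
  refine ⟨⟨fun y => ?_, htU, fun y hy => ?_, fun y z hz => ?_⟩,
    ⟨hle, htP, hQ, fun h => ?_, fun y hy hty => ?_⟩, hlx.le⟩
  · by_cases hy : y = x
    · rw [hy, hlx]; exact hlc
    · rw [hly y hy]; exact hs.lstar_le y
  · rcases Finset.mem_union.1 (hQ' hy) with hy | hy
    · exact hs.queue y hy
    · rw [Finset.mem_singleton.1 hy]; exact hx
  · by_cases hy : y = x
    · subst hy
      rw [htb, Function.update_self] at hz
      rw [hlx]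
      exact (hB z hz).imp_right fun h => ⟨h.1, (hle z).trans_lt h.2⟩
    · rw [htb, Function.update_of_ne hy] at hz
      rw [hly y hy]
      exact (hs.retrace y z hz).imp_right fun h => ⟨h.1, (hle z).trans_lt h.2⟩
  · exact absurd (hlx.symm.trans (congrFun h x)) hc.ne
  · by_cases hyx : y = x
    · subst hyx
      right
      rw [ht, hans hy (hlx.symm.trans hty)]
      simp [State.push]
    · exact Or.inl ((hly y hyx).symm.trans hty)

theorem Inv.lstar_le_assign {s : State V} (hs : Inv N R r s) {x : Tuple V} {c : ℕ∞}
    {B : Finset (Tuple V)} (hlc : (lstar N x.1 x.2 : ℕ∞) ≤ c) (y : Tuple V) :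
    (lstar N y.1 y.2 : ℕ∞) ≤ (s.assign x c B).l y := by
  by_cases hy : y = x
  · subst hy
    simpa [State.assign] using hlc
  · simpa [State.assign, Function.update_of_ne hy] using hs.lstar_le y

theorem CombineBody.spec {pruning : Bool} {u : V} {I J : Finset V} {s t : State V}
    (hs : Inv N R r s) (hI : I.Nonempty) (hIR : I ⊆ R \ {r}) (hJ : J.Nonempty)
    (hJR : J ⊆ (R \ {r}) \ I) (h : CombineBody N R pruning u I J s t) :
    Inv N R r t ∧ Evolves N R r s t ∧ t.l (u, I ∪ J) ≤ s.l (u, I) + s.l (u, J) := by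
  unfold CombineBody at h
  by_cases hlt : s.l (u, I) + s.l (u, J) < s.l (u, I ∪ J)
  · rw [if_pos hlt] at h
    obtain ⟨ans, m, hp, ht⟩ := h
    have hdisj : Disjoint I J := (Finset.subset_sdiff.1 hJR).2.symm
    have hlc : (lstar N u (I ∪ J) : ℕ∞) ≤ s.l (u, I) + s.l (u, J) := by
      refine (Nat.cast_le.2 (lstar_union_le N u I J)).trans ?_
      rw [Nat.cast_add]
      exact add_le_add (hs.lstar_le (u, I)) (hs.lstar_le (u, J))
    have hB : ∀ z ∈ ({(u, I), (u, J)} : Finset (Tuple V)), z.2 ⊂ I ∪ J ∨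
        z.2 = I ∪ J ∧ s.l z < s.l (u, I) + s.l (u, J) := by
      intro z hz
      left
      rcases Finset.mem_insert.1 hz with rfl | hz
      · refine Finset.ssubset_iff_subset_ne.2 ⟨Finset.subset_union_left, fun he => ?_⟩
        obtain ⟨x, hx⟩ := hJ
        have hxI : x ∈ I := by rw [show I = I ∪ J from he]; exact Finset.mem_union_right _ hx
        exact Finset.disjoint_left.1 hdisj hxI hx
      · rw [Finset.mem_singleton.1 hz]
        refine Finset.ssubset_iff_subset_ne.2 ⟨Finset.subset_union_right, fun he => ?_⟩
        obtain ⟨x, hx⟩ := hI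
        have hxJ : x ∈ J := by rw [show J = I ∪ J from he]; exact Finset.mem_union_left _ hx
        exact Finset.disjoint_left.1 hdisj hx hxJ
    have hx : (I ∪ J).Nonempty ∧ I ∪ J ⊆ R \ {r} :=
      ⟨hI.mono Finset.subset_union_left,
        Finset.union_subset hIR (hJR.trans Finset.sdiff_subset)⟩
    split_ifs at hp
    · obtain ⟨hub, hans⟩ := hp
      obtain ⟨c1, c2, c3, c4, c5⟩ := combineBounds_spec (N := N) (R := R) (J₁ := I) (J₂ := J)
        (s := s.assign (u, I ∪ J) (s.l (u, I) + s.l (u, J)) {(u, I), (u, J)}) hs.bounds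
      obtain ⟨m1, m2, m3, m4, m5⟩ := hub.spec
        (by rw [c2]; exact hs.lstar_le_assign (x := (u, I ∪ J)) hlc (u, I ∪ J)) c1
      refine hs.relax (x := (u, I ∪ J)) hx hlt hlc hB m1 (m2.trans c2) (m3.trans c3)
        (m4.trans c4) (m5.trans c5) (fun hg hc => ?_) ht
      rw [Bool.eq_false_iff]
      intro h'
      refine absurd (hans.1 h') (not_lt.2 ?_)
      rw [m2, c2]
      simp only [State.assign, Function.update_self]
      rw [hc]
      exact m1.lstar_le hg
    · obtain ⟨rfl, rfl⟩ := hp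
      exact hs.relax (x := (u, I ∪ J)) (m := s.assign (u, I ∪ J) _ _) hx hlt hlc hB hs.bounds
        rfl rfl rfl rfl
        (fun _ _ => rfl) ht
  · rw [if_neg hlt] at h
    subst h
    exact ⟨hs, .refl _, not_lt.1 hlt⟩

/-- The edge `uv` is moved from the tree for `I` to the tree for `R \ I`. -/
theorem Splits.of_adj {u v : V} {I : Finset V} (huv : N.graph.Adj u v)
    (h : Splits N R r (v, I)) (hc : lstar N u I + N.cost s(u, v) ≤ lstar N v I) :
    Splits N R r (u, I) := by
  refine ⟨h.1, h.2.1, ?_⟩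
  have h1 := lstar_le_of_adj N huv.symm (R \ I)
  rw [Sym2.eq_swap] at h1
  have h2 := h.2.2
  simp only at h2 ⊢
  omega

/-- The tree for `J` is moved to the side of the remaining terminals. -/
theorem Splits.of_union {u : V} {I J : Finset V} (hI : I.Nonempty) (hIJ : Disjoint I J)
    (h : Splits N R r (u, I ∪ J)) (hc : lstar N u I + lstar N u J ≤ lstar N u (I ∪ J)) :
    Splits N R r (u, I) := by
  refine ⟨hI, Finset.subset_union_left.trans h.2.1, ?_⟩
  have h1 := lstar_union_le N u J (R \ (I ∪ J))
  have h3 : J ∪ R \ (I ∪ J) = R \ I := by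
    have hJR : J ⊆ R := Finset.subset_union_right.trans (h.2.1.trans Finset.sdiff_subset)
    ext x
    have h1 := @hJR x
    have h2 : x ∈ I → x ∉ J := fun h => Finset.disjoint_left.1 hIJ h
    simp only [Finset.mem_union, Finset.mem_sdiff]
    tauto
  rw [h3] at h1
  have h2 := h.2.2
  simp only at h2 ⊢
  omega

theorem PropagateBody.spec {pruning : Bool} {u v : V} {I : Finset V} {s t : State V}
    (hs : Inv N R r s) (hI : I.Nonempty) (hIR : I ⊆ R \ {r}) (huv : N.graph.Adj u v)
    (h : PropagateBody N R pruning u I v s t) :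
    Inv N R r t ∧ Evolves N R r s t ∧ t.l (v, I) ≤ s.l (u, I) + N.cost s(u, v) := by
  unfold PropagateBody at h
  by_cases hlt : s.l (u, I) + N.cost s(u, v) < s.l (v, I)
  · rw [if_pos hlt] at h
    obtain ⟨ans, m, hp, ht⟩ := h
    have hlc : (lstar N v I : ℕ∞) ≤ s.l (u, I) + N.cost s(u, v) := by
      refine (Nat.cast_le.2 (lstar_le_of_adj N huv I)).trans ?_
      rw [Nat.cast_add]
      exact add_le_add (hs.lstar_le (u, I)) le_rfl
    have htop : s.l (u, I) ≠ ⊤ := by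
      intro h'
      simp [h'] at hlt
    have hB : ∀ z ∈ ({(u, I)} : Finset (Tuple V)), z.2 ⊂ I ∨
        z.2 = I ∧ s.l z < s.l (u, I) + N.cost s(u, v) := by
      intro z hz
      rw [Finset.mem_singleton.1 hz]
      refine Or.inr ⟨rfl, ?_⟩
      -- Positive edge costs make the label drop strictly along the retrace pointer.
      have hpos := N.cost_pos s(u, v) huv
      lift s.l (u, I) to ℕ using htop with k
      exact_mod_cast Nat.lt_add_of_pos_right hpos
    split_ifs at hp
    · obtain ⟨hub, hans⟩ := hp
      obtain ⟨m1, m2, m3, m4, m5⟩ := hub.spec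
        (hs.lstar_le_assign (x := (v, I)) hlc (u, I)) hs.bounds
      refine hs.relax (x := (v, I)) ⟨hI, hIR⟩ hlt hlc hB m1 m2 m3 m4 m5 (fun hg hc => ?_) ht
      -- The call tests the predecessor `(u, I)`. If the new label of `(v, I)` is exact, then so is
      -- that of `(u, I)`, which splits too, so no valid bound lies below it.
      have hle := hs.lstar_le (u, I)
      have hadj := lstar_le_of_adj N huv I
      rw [Bool.eq_false_iff]
      intro h'
      refine absurd (hans.1 h') (not_lt.2 ?_)
      rw [m2]
      have hne : (u, I) ≠ (v, I) := fun he => huv.ne (congrArg Prod.fst he)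
      simp only [State.assign, Function.update_of_ne hne]
      lift s.l (u, I) to ℕ using htop with k
      norm_cast at hc hle
      have hk : k = lstar N u I := by omega
      rw [hk]
      exact m1.lstar_le (hg.of_adj huv (by omega))
    · obtain ⟨rfl, rfl⟩ := hp
      exact hs.relax (x := (v, I)) (m := s.assign (v, I) _ _) ⟨hI, hIR⟩ hlt hlc hB
        hs.bounds rfl rfl rfl rfl
        (fun _ _ => rfl) ht
  · rw [if_neg hlt] at h
    subst h
    exact ⟨hs, .refl _, not_lt.1 hlt⟩

/-- Each bound may be read off in the initial state, because labels only decrease and `bound` is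
monotone. -/
theorem RunList.spec {α : Type*} {body : α → State V → State V → Prop} {L : List α}
    {target : α → Tuple V} {bound : α → (Tuple V → ℕ∞) → ℕ∞}
    (hmono : ∀ a, Monotone (bound a))
    (hbody : ∀ a ∈ L, ∀ s t, Inv N R r s → body a s t →
      Inv N R r t ∧ Evolves N R r s t ∧ t.l (target a) ≤ bound a s.l)
    {s t : State V} (hs : Inv N R r s) (h : RunList body L s t) :
    Inv N R r t ∧ Evolves N R r s t ∧ ∀ a ∈ L, t.l (target a) ≤ bound a s.l := by
  induction L generalizing s with
  | nil =>
    obtain rfl : t = s := h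
    exact ⟨hs, .refl _, by simp⟩
  | cons a L ih =>
    obtain ⟨m, hm, h⟩ := h
    obtain ⟨hm1, hm2, hm3⟩ := hbody a (by simp) s m hs hm
    obtain ⟨ht1, ht2, ht3⟩ := ih (fun b hb => hbody b (by simp [hb])) hm1 h
    refine ⟨ht1, hm2.trans ht2, fun b hb => ?_⟩
    rcases List.mem_cons.1 hb with rfl | hb
    · exact (ht2.l_le _).trans hm3
    · exact (ht3 b hb).trans (hmono b hm2.l_le)

theorem exists_runList {α σ : Type*} {body : α → σ → σ → Prop}
    (h : ∀ a s, ∃ t, body a s t) (L : List α) (s : σ) : ∃ t, RunList body L s t := by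
  induction L generalizing s with
  | nil => exact ⟨s, rfl⟩
  | cons a L ih =>
    obtain ⟨m, hm⟩ := h a s
    obtain ⟨t, ht⟩ := ih m
    exact ⟨t, m, hm, ht⟩

theorem exists_forEach {α σ : Type*} [Finite α] {p : α → Prop} {body : α → σ → σ → Prop}
    (h : ∀ a s, ∃ t, body a s t) (s : σ) : ∃ t, ForEach p body s t := by
  obtain ⟨t, ht⟩ := exists_runList h (Set.toFinite {x | p x}).toFinset.toList s
  exact ⟨t, _, Finset.nodup_toList _, by simp, ht⟩

theorem exists_prune (v : V) (J : Finset V) (s : State V) :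
    ∃ ans t, Prune N R v J s ans t := by
  classical
  obtain ⟨t, ht⟩ := exists_updateBound (N := N) (R := R) v J s
  exact ⟨decide (t.U J < t.l (v, J)), t, ht, by simp⟩

theorem exists_combineBody (pruning : Bool) (u : V) (I J : Finset V) (s : State V) :
    ∃ t, CombineBody N R pruning u I J s t := by
  unfold CombineBody
  split_ifs
  · obtain ⟨ans, m, hm⟩ := exists_prune (N := N) (R := R) u (I ∪ J) (combineBounds I J
      (s.assign (u, I ∪ J) (s.l (u, I) + s.l (u, J)) {(u, I), (u, J)}))
    exact ⟨_, ans, m, hm, rfl⟩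
  · exact ⟨_, false, _, ⟨rfl, rfl⟩, rfl⟩
  · exact ⟨s, rfl⟩

theorem exists_propagateBody (pruning : Bool) (u : V) (I : Finset V) (v : V) (s : State V) :
    ∃ t, PropagateBody N R pruning u I v s t := by
  unfold PropagateBody
  split_ifs
  · obtain ⟨ans, m, hm⟩ := exists_prune (N := N) (R := R) u I
      (s.assign (v, I) (s.l (u, I) + N.cost s(u, v)) {(u, I)})
    exact ⟨_, ans, m, hm, rfl⟩
  · exact ⟨_, false, _, ⟨rfl, rfl⟩, rfl⟩
  · exact ⟨s, rfl⟩

theorem exists_step (pruning : Bool) (h : V → Finset V → ℕ) {s : State V}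
    (hP : (r, R \ {r}) ∉ s.P) (hQ : s.Q.Nonempty) : ∃ t, Step N R pruning r h s t := by
  obtain ⟨⟨u, I⟩, hx, hmin⟩ := Finset.exists_min_image s.Q (estimate R h s) hQ
  obtain ⟨m, hm⟩ := exists_forEach (p := fun J => J ≠ ∅ ∧ J ⊆ (R \ {r}) \ I ∧
    (u, J) ∈ s.P ∪ {(u, I)}) (exists_combineBody (N := N) (R := R) pruning u I)
    (s.expand (u, I))
  obtain ⟨t, ht⟩ := exists_forEach (p := fun v => N.graph.Adj u v)
    (exists_propagateBody (N := N) (R := R) pruning u I) m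
  exact ⟨t, hP, u, I, hx, hmin, m, hm, ht⟩

end Invariants

/-! ### Correctness and termination of the main loop -/

section MainLoop

variable {V : Type*} [Finite V] [DecidableEq V] (N : Network V) (R : Finset V) (r : V)

/-- The invariants at the head of the main loop. -/
structure HeadInv (s : State V) : Prop extends Inv N R r s where
  l_le_start : ∀ x, s.l x ≤ (start R r).l x
  reached : ∀ x, Splits N R r x → Tight N s x → x ∈ s.Q ∨ x ∈ s.P
  propagated : ∀ u v I, Splits N R r (u, I) → Tight N s (u, I) → (u, I) ∉ s.Q →
    N.graph.Adj u v → s.l (v, I) ≤ s.l (u, I) + N.cost s(u, v)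
  combined : ∀ u I J, Splits N R r (u, I) → Tight N s (u, I) → (u, I) ∉ s.Q →
    Splits N R r (u, J) → Tight N s (u, J) → (u, J) ∉ s.Q → Disjoint I J →
    s.l (u, I ∪ J) ≤ s.l (u, I) + s.l (u, J)
  root : (r, R \ {r}) ∈ s.P → Tight N s (r, R \ {r})

variable {N R r}

theorem splits_root (hr : r ∈ R) (hR : (R \ {r}).Nonempty) : Splits N R r (r, R \ {r}) := by
  refine ⟨hR, subset_rfl, ?_⟩
  have h1 : R \ (R \ {r}) = {r} := by
    rw [Finset.sdiff_sdiff_eq_self (Finset.singleton_subset_iff.2 hr)]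
  have h2 : lstar N r (R \ {r}) = csmt N R := by
    rw [lstar, Finset.sdiff_union_of_subset (Finset.singleton_subset_iff.2 hr)]
  simp only [h1, h2, lstar_self, add_zero, le_refl]

theorem headInv_start : HeadInv N R r (start R r) := by
  have htight : ∀ x, Splits N R r x → Tight N (start R r) x → x ∈ (start R r).Q := by
    intro x hx ht
    simp only [Tight, start] at ht
    split_ifs at ht with hc
    · rcases hc with hc | ⟨h1, h2⟩
      · exact absurd hc hx.1.ne_empty
      · exact Finset.mem_image.2 ⟨x.1, h1, Prod.ext rfl h2.symm⟩
    · exact absurd ht.symm (ENat.natCast_ne_top _)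
  refine ⟨⟨fun x => ?_, fun J hJ => absurd rfl hJ, fun x hx => ?_, fun x z hz => ?_⟩,
    fun x => le_rfl, fun x hx ht => Or.inl (htight x hx ht), fun u v I hx ht hQ => ?_,
    fun u I J hx ht hQ => ?_, fun h => ?_⟩
  · simp only [start]
    split_ifs with hc
    · rcases hc with hc | ⟨-, hc⟩
      · rw [hc, lstar_empty]; simp
      · rw [hc, lstar_self]; simp
    · exact le_top
  · obtain ⟨u, hu, rfl⟩ := Finset.mem_image.1 hx
    exact ⟨Finset.singleton_nonempty u, Finset.singleton_subset_iff.2 hu⟩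
  · simp [start] at hz
  · exact absurd (htight _ hx ht) hQ
  · exact absurd (htight _ hx ht) hQ
  · simp [start] at h

/-- Induction along an optimal derivation: its parts are optimal and split, so they are exact, hence
not queued, hence already propagated or combined. -/
theorem HeadInv.tight_of_derives {s : State V} (hs : HeadInv N R r s)
    (hQ : ∀ x ∈ s.Q, Splits N R r x → ¬ Tight N s x) {u : V} {I : Finset V} {c : ℕ}
    (hd : Derives N u I c) (hI : Splits N R r (u, I)) (hc : c = lstar N u I) :
    Tight N s (u, I) := by
  have hnQ : ∀ x, Splits N R r x → Tight N s x → x ∉ s.Q := fun x hx ht h => hQ x h hx ht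
  induction hd with
  | base u =>
    refine le_antisymm ?_ (hs.lstar_le _)
    refine (hs.l_le_start _).trans ?_
    have hu : u ∈ R \ {r} := Finset.singleton_subset_iff.1 hI.2.1
    exact (if_pos (Or.inr ⟨hu, rfl⟩)).trans_le zero_le
  | @propagate u v I c huv h ih =>
    have h1 := h.lstar_le
    have h2 := lstar_le_of_adj N huv I
    have hu : Splits N R r (u, I) := hI.of_adj huv (by omega)
    have ht := ih hu (by omega)
    refine le_antisymm ((hs.propagated u v I hu ht (hnQ _ hu ht) huv).trans ?_)
      (hs.lstar_le _)
    rw [ht]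
    simp only
    rw [← hc, Nat.cast_add]
    gcongr
  | @combine u I J c d hIJ h h' ih ih' =>
    have h1 := h.lstar_le
    have h2 := h'.lstar_le
    have h3 := lstar_union_le N u I J
    have hu : Splits N R r (u, I) := hI.of_union h.nonempty hIJ (by omega)
    have hu' : Splits N R r (u, J) := by
      rw [Finset.union_comm] at hI hc h3
      exact hI.of_union h'.nonempty hIJ.symm (by omega)
    have ht := ih hu (by omega)
    have ht' := ih' hu' (by omega)
    refine le_antisymm ((hs.combined u I J hu ht (hnQ _ hu ht) hu' ht' (hnQ _ hu' ht')
      hIJ).trans ?_) (hs.lstar_le _)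
    rw [ht, ht']
    simp only
    rw [← Nat.cast_add, Nat.cast_le]
    omega

theorem HeadInv.exists_tight_mem_queue {s : State V} (hs : HeadInv N R r s) (hr : r ∈ R)
    (hR : (R \ {r}).Nonempty) (hP : (r, R \ {r}) ∉ s.P) :
    ∃ x ∈ s.Q, Splits N R r x ∧ Tight N s x := by
  by_contra! hQ
  have hroot := splits_root (N := N) hr hR
  have ht := hs.tight_of_derives hQ (derives_lstar r hR) hroot rfl
  exact (hs.reached _ hroot ht).elim (fun h => hQ _ h hroot ht) hP

theorem Step.spec {pruning : Bool} {h : V → Finset V → ℕ} {s t : State V}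
    (hs : Inv N R r s) (hst : Step N R pruning r h s t) :
    ∃ u I, (u, I) ∈ s.Q ∧ (∀ y ∈ s.Q, estimate R h s (u, I) ≤ estimate R h s y) ∧
      Inv N R r t ∧ Evolves N R r (s.expand (u, I)) t ∧
      (∀ v, N.graph.Adj u v → ∃ m, Evolves N R r (s.expand (u, I)) m ∧ Evolves N R r m t ∧
        t.l (v, I) ≤ m.l (u, I) + N.cost s(u, v)) ∧
      ∀ J, J ≠ ∅ → J ⊆ (R \ {r}) \ I → (u, J) ∈ s.P ∪ {(u, I)} →
        t.l (u, I ∪ J) ≤ s.l (u, I) + s.l (u, J) := by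
  obtain ⟨-, u, I, hx, hmin, m, ⟨L, -, hL, hm⟩, ⟨L', -, hL', ht⟩⟩ := hst
  obtain ⟨hI, hIR⟩ := hs.queue _ hx
  have hs' : Inv N R r (s.expand (u, I)) :=
    ⟨hs.lstar_le, hs.bounds, fun y hy => hs.queue y (Finset.sdiff_subset hy), hs.retrace⟩
  obtain ⟨m1, m2, m3⟩ := RunList.spec (target := fun J => (u, I ∪ J))
    (bound := fun J l => l (u, I) + l (u, J))
    (fun J _ _ hl => add_le_add (hl _) (hl _))
    (fun J hJ s t hs h => h.spec hs hI hIR (Finset.nonempty_iff_ne_empty.2 ((hL J).1 hJ).1)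
      ((hL J).1 hJ).2.1) hs' hm
  obtain ⟨t1, t2, t3⟩ := RunList.spec (target := fun v => (v, I))
    (bound := fun v l => l (u, I) + N.cost s(u, v))
    (fun v _ _ hl => add_le_add (hl _) le_rfl)
    (fun v hv s t hs h => h.spec hs hI hIR ((hL' v).1 hv)) m1 ht
  exact ⟨u, I, hx, hmin, t1, m2.trans t2, fun v hv => ⟨m, m2, t2, t3 v ((hL' v).2 hv)⟩,
    fun J h1 h2 h3 => (t2.l_le _).trans (m3 J ((hL J).2 ⟨h1, h2, h3⟩))⟩

theorem HeadInv.step {pruning : Bool} {h : V → Finset V → ℕ} {s t : State V}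
    (hr : r ∈ R) (hadm : Admissible N R r h) (hs : HeadInv N R r s)
    (hst : Step N R pruning r h s t) : HeadInv N R r t := by
  obtain ⟨u, I, hx, hmin, ht, hev, hprop, hcomb⟩ := hst.spec hs.toInv
  have hP : (r, R \ {r}) ∉ s.P := hst.1
  have htP : t.P = s.P ∪ {(u, I)} := hev.P_eq
  have hold : ∀ y, Splits N R r y → Tight N t y → y ∉ t.Q →
      Tight N s y ∧ y ∈ s.P ∪ {(u, I)} ∧ (y ≠ (u, I) → y ∉ s.Q) := by
    intro y hy hty hyQ
    have hsy : Tight N s y := (hev.tight y hy hty).resolve_right hyQ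
    have hyQ' : y ≠ (u, I) → y ∉ s.Q := fun hne hys => hyQ <| hev.Q_subset <|
      Finset.mem_sdiff.2 ⟨hys, fun h => hne (Finset.mem_singleton.1 h)⟩
    refine ⟨hsy, ?_, hyQ'⟩
    by_cases hne : y = (u, I)
    · exact Finset.mem_union_right _ (Finset.mem_singleton.2 hne)
    · exact Finset.mem_union_left _ ((hs.reached y hy hsy).resolve_left (hyQ' hne))
  refine ⟨ht, fun y => (hev.l_le y).trans (hs.l_le_start y), fun y hy hty => ?_, ?_, ?_, ?_⟩
  · by_cases hyQ : y ∈ t.Q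
    · exact Or.inl hyQ
    · exact Or.inr (htP ▸ (hold y hy hty hyQ).2.1)
  · intro u' v I' hy hty hyQ huv
    obtain ⟨hsy, -, hyQ'⟩ := hold _ hy hty hyQ
    by_cases hne : (u', I') = (u, I)
    · obtain ⟨rfl, rfl⟩ := Prod.mk.inj hne
      obtain ⟨m, -, hm, hle⟩ := hprop v huv
      -- Propagation reads the label in the state `m` between the two loops. A tuple exact in `t`
      -- and not queued there was already exact in `m`.
      have hmy : Tight N m (u', I') := (hm.tight _ hy hty).resolve_right hyQ
      rw [hty.trans hmy.symm]
      exact hle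
    · rw [hty.trans hsy.symm]
      exact (hev.l_le _).trans (hs.propagated u' v I' hy hsy (hyQ' hne) huv)
  · intro u' I' J hy hty hyQ hz htz hzQ hdisj
    obtain ⟨hsy, hyP, hyQ'⟩ := hold _ hy hty hyQ
    obtain ⟨hsz, hzP, hzQ'⟩ := hold _ hz htz hzQ
    rw [hty.trans hsy.symm, htz.trans hsz.symm]
    -- If either tuple is the one being expanded, the other is in the updated `P` and the
    -- combination is done now; otherwise the old invariant applies.
    by_cases hne : (u', I') = (u, I)
    · obtain ⟨rfl, rfl⟩ := Prod.mk.inj hne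
      exact hcomb J hz.1.ne_empty (Finset.subset_sdiff.2 ⟨hz.2.1, hdisj.symm⟩) hzP
    · by_cases hne' : (u', J) = (u, I)
      · obtain ⟨rfl, rfl⟩ := Prod.mk.inj hne'
        rw [Finset.union_comm, add_comm]
        exact hcomb I' hy.1.ne_empty (Finset.subset_sdiff.2 ⟨hy.2.1, hdisj⟩) hyP
      · exact (hev.l_le _).trans
          (hs.combined u' I' J hy hsy (hyQ' hne) hz hsz (hzQ' hne') hdisj)
  · intro hroot
    rw [htP] at hroot
    have hxe := Finset.mem_singleton.1 ((Finset.mem_union.1 hroot).resolve_left hP)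
    have hR : (R \ {r}).Nonempty := by
      have := (hs.queue _ hx).1
      rwa [← hxe] at this
    obtain ⟨y, hyQ, hy, hsy⟩ := hs.exists_tight_mem_queue hr hR hP
    refine le_antisymm ((hev.l_le _).trans ?_) (ht.lstar_le _)
    -- The chosen tuple has the least estimate, and the heuristic is nonnegative.
    have h1 : s.l (r, R \ {r}) ≤ estimate R h s y := by
      refine le_trans ?_ (hmin y hyQ)
      rw [← hxe]
      exact le_self_add
    refine h1.trans ?_
    have hrR : {r} ⊆ R \ y.2 := Finset.singleton_subset_iff.2 <|
      Finset.mem_sdiff.2 ⟨hr, fun h => by simpa using hy.2.1 h⟩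
    have h2 := hadm y.1 (R \ y.2) hrR Finset.sdiff_subset
    have h3 := hy.2.2
    have h4 : csmt N R = lstar N r (R \ {r}) := by
      rw [lstar, Finset.sdiff_union_of_subset (Finset.singleton_subset_iff.2 hr)]
    rw [estimate, hsy, ← Nat.cast_add, Nat.cast_le]
    simp only
    omega

theorem headInv_of_reachable {pruning : Bool} {h : V → Finset V → ℕ} {s : State V}
    (hr : r ∈ R) (hadm : Admissible N R r h) (hs : Reachable N R pruning r h s) :
    HeadInv N R r s := by
  induction hs with
  | refl => exact headInv_start
  | tail _ hst ih => exact ih.step hr hadm hst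

/-- Either some label drops, or nothing is pushed and the queue loses the expanded tuple. Labels are
functions from a finite type to `ℕ∞`, so this order is well-founded. -/
theorem Step.prodLex {pruning : Bool} {h : V → Finset V → ℕ} {s t : State V}
    (hs : Inv N R r s) (hst : Step N R pruning r h s t) :
    Prod.Lex (· < ·) (· < ·) (t.l, t.Q.card) (s.l, s.Q.card) := by
  obtain ⟨u, I, hx, -, -, hev, -⟩ := hst.spec hs
  rw [Prod.lex_iff]
  have hle : t.l ≤ s.l := hev.l_le
  rcases hle.lt_or_eq with hlt | heq
  · exact Or.inl hlt
  · right
    have hQ : t.Q = s.Q \ {(u, I)} := hev.Q_eq heq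
    refine ⟨heq, ?_⟩
    simp only [hQ, Finset.sdiff_singleton_eq_erase]
    exact Finset.card_erase_lt_of_mem hx

theorem not_exists_run {pruning : Bool} {h : V → Finset V → ℕ} (hr : r ∈ R)
    (hadm : Admissible N R r h) : ¬ ∃ run : ℕ → State V, run 0 = start R r ∧
      ∀ n, Step N R pruning r h (run n) (run (n + 1)) := by
  rintro ⟨run, h0, hrun⟩
  have hreach : ∀ n, Reachable N R pruning r h (run n) := by
    intro n
    induction n with
    | zero => rw [h0]; exact Relation.ReflTransGen.refl
    | succ n ih => exact Relation.ReflTransGen.tail ih (hrun n)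
  have hwf : WellFounded (Prod.Lex (· < · : (Tuple V → ℕ∞) → _ → Prop)
      (· < · : ℕ → ℕ → Prop)) := WellFounded.prod_lex wellFounded_lt wellFounded_lt
  refine (wellFounded_iff_isEmpty_descending_chain.1 hwf).false
    ⟨fun n => ((run n).l, (run n).Q.card), fun n => ?_⟩
  exact (hrun n).prodLex (headInv_of_reachable hr hadm (hreach n)).toInv

theorem Inv.retraceTerminates {s : State V} (hs : Inv N R r s) (x : Tuple V) :
    RetraceTerminates s x := by
  have hwf : WellFounded (InvImage (Prod.Lex (· < · : ℕ → ℕ → Prop)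
      (· < · : ℕ∞ → ℕ∞ → Prop)) fun x : Tuple V => (x.2.card, s.l x)) :=
    InvImage.wf _ (WellFounded.prod_lex wellFounded_lt wellFounded_lt)
  refine Subrelation.accessible (fun {z y} hz => ?_) (hwf.apply x)
  change Prod.Lex _ _ _ _
  rw [Prod.lex_iff]
  exact (hs.retrace y z hz).imp (fun h => Finset.card_lt_card h)
    fun h => ⟨congrArg Finset.card h.1, h.2⟩

end MainLoop

end DSStar

theorem theorem1 {V : Type*} [Finite V] [DecidableEq V] (N : DSStar.Network V)
    (R : Finset V) (r : V) (hr : r ∈ R) (h : V → Finset V → ℕ)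
    (hadm : DSStar.Admissible N R r h) (pruning : Bool) :
    -- the main loop performs finitely many iterations in every run
    (¬ ∃ run : ℕ → DSStar.State V, run 0 = DSStar.start R r ∧
      ∀ n, DSStar.Step N R pruning r h (run n) (run (n + 1))) ∧
    -- whenever it has come to an end
    ∀ s : DSStar.State V, DSStar.Reachable N R pruning r h s →
      DSStar.Halted N R pruning r h s →
      -- it has done so because the loop condition failed (not because the queue ran empty)
      (R ≠ {r} → (r, R \ {r}) ∈ s.P) ∧
      -- the final retracing terminates as well
      DSStar.RetraceTerminates s (r, R \ {r}) ∧
      -- and the computed value is the cost of a Steiner minimal tree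
      s.l (r, R \ {r}) = (DSStar.lstar N r (R \ {r}) : ℕ∞) ∧
      DSStar.lstar N r (R \ {r}) = DSStar.csmt N R ∧
      ∃ T : N.graph.Subgraph, DSStar.IsSMT N R T ∧
        DSStar.subgraphCost N T = DSStar.csmt N R := by
  refine ⟨DSStar.not_exists_run hr hadm, fun s hs hhalt => ?_⟩
  have hinv := DSStar.headInv_of_reachable hr hadm hs
  have hP : R ≠ {r} → (r, R \ {r}) ∈ s.P := by
    intro hne
    by_contra hP
    have hR : (R \ {r}).Nonempty := Finset.sdiff_nonempty.2 fun hsub =>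
      hne (hsub.antisymm (Finset.singleton_subset_iff.2 hr))
    obtain ⟨x, hx, -⟩ := hinv.exists_tight_mem_queue hr hR hP
    exact hhalt (DSStar.exists_step pruning h hP ⟨x, hx⟩)
  refine ⟨hP, hinv.retraceTerminates _, ?_, ?_, DSStar.exists_isSMT N (A := R) ⟨r, hr⟩⟩
  -- For `R = {r}` the label of `(r, ∅)` is `0` from the start.
  · by_cases hR : R = {r}
    · have h0 : R \ {r} = ∅ := by simp [hR]
      refine le_antisymm ((hinv.l_le_start (r, R \ {r})).trans ?_) (hinv.lstar_le (r, R \ {r}))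
      simp [DSStar.start, h0]
    · exact hinv.root (hP hR)
  · rw [DSStar.lstar, Finset.sdiff_union_of_subset (Finset.singleton_subset_iff.2 hr)]
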